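/- Let $d\ge 1$, let $\mu$ be a Borel probability measure on $\mathbb{R}^d$ and let $f(x)=w^Tx+b$ with $w\in\mathbb{R}^d$, $b\in\mathbb{R}$. For $\eta\ge 0$ let $\eta\mathbb{S}$ be the uniform probability measure on the sphere of radius $\eta$ centred at $0$ in $\mathbb{R}^d$. For $x\in\mathbb{R}^d$ and $\epsilon\in[0,1]$ put, with values in $[0,\infty]$, $$\Delta_{\mathrm{adv}}(x;f)=\inf\{\|r\|_2 : r\in\mathbb{R}^d,\ f(x)f(x+r)\le 0\},\qquad \Delta_{\mathrm{unif},\epsilon}(x;f)=\sup\{\eta\ge 0 : \mathbb{P}_{n\sim\eta\mathbb{S}}(f(x)f(x+n)\le 0)\le\epsilon\}$$ (where $\inf\emptyset=\infty$, $\sup\emptyset=0$), and $$\rho_{\mathrm{adv}}(f)=\mathbb{E}_{x\sim\mu}\,\Delta_{\mathrm{adv}}(x;f),\qquad \rho_{\mathrm{unif},\epsilon}(f)=\mathbb{E}_{x\sim\mu}\,\Delta_{\mathrm{unif},\epsilon}(x;f).$$ Then for every $\epsilon\in[0,1/12)$ the functions $\Delta_{\mathrm{adv}}(\cdot\,;f)$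 and $\Delta_{\mathrm{unif},\epsilon}(\cdot\,;f)$ are measurable, and $$\max\bigl(C_1(\epsilon)\sqrt d,\,1\bigr)\,\rho_{\mathrm{adv}}(f)\ \le\ \rho_{\mathrm{unif},\epsilon}(f)\ \le\ \widetilde{C_2}(\epsilon,d)\,\rho_{\mathrm{adv}}(f)\ \le\ C_2(\epsilon)\sqrt d\,\rho_{\mathrm{adv}}(f),$$ where $C_1(\epsilon)=(2\ln(2/\epsilon))^{-1/2}$ for $\epsilon>0$ and $C_1(0)=0$, $\widetilde{C_2}(\epsilon,d)=(1-(12\epsilon)^{1/d})^{-1/2}$ and $C_2(\epsilon)=(1-12\epsilon)^{-1/2}$. Moreover, if $w\ne 0$ and $\mu$ has bounded support (that is, $\mu(\{x:\|x\|_2\le M\})=1$ for some $M$), then $\rho_{\mathrm{adv}}(f)$ and $\rho_{\mathrm{unif},\epsilon}(f)$ are finite. -/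

import Mathlib

open MeasureTheory
open scoped ENNReal NNReal

namespace Robustness

noncomputable section

/-- The linear classification function `f(x) = wᵀ x + b` on `ℝ^d`. -/
def linearClassifier {d : ℕ} (w : EuclideanSpace ℝ (Fin d)) (b : ℝ) :
    EuclideanSpace ℝ (Fin d) → ℝ :=
  fun x => inner ℝ w x + b

/-- The uniform probability measure on the sphere of radius `η` centred at `0` in `ℝ^d`:
the normalized surface measure of the unit sphere, pushed forward by `n ↦ η n`
(for `η = 0` it is the Dirac mass at `0`). -/
def uniformSphere (d : ℕ) (η : ℝ≥0) : Measure (EuclideanSpace ℝ (Fin d)) :=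
  ((((volume : Measure (EuclideanSpace ℝ (Fin d))).toSphere Set.univ)⁻¹ •
      (volume : Measure (EuclideanSpace ℝ (Fin d))).toSphere)).map
    (fun n : Metric.sphere (0 : EuclideanSpace ℝ (Fin d)) 1 =>
      (η : ℝ) • (n : EuclideanSpace ℝ (Fin d)))

/-- The norm of the smallest perturbation `r` with `f(x) f(x + r) ≤ 0`, as an element of `[0, ∞]`
(it is `∞` if there is no such perturbation). -/
def deltaAdv {d : ℕ} (f : EuclideanSpace ℝ (Fin d) → ℝ) (x : EuclideanSpace ℝ (Fin d)) : ℝ≥0∞ :=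
  ⨅ (r : EuclideanSpace ℝ (Fin d)) (_ : f x * f (x + r) ≤ 0), ‖r‖ₑ

/-- The largest radius `η ≥ 0` such that noise `n` drawn uniformly from the sphere of radius `η`
satisfies `f(x) f(x + n) ≤ 0` with probability at most `ε`, as a supremum in `[0, ∞]`
(it is `0` if no radius qualifies, which happens when `f(x) = 0` and `ε < 1`). -/
def deltaUnif {d : ℕ} (ε : ℝ) (f : EuclideanSpace ℝ (Fin d) → ℝ)
    (x : EuclideanSpace ℝ (Fin d)) : ℝ≥0∞ :=
  ⨆ (η : ℝ≥0) (_ : uniformSphere d η {n | f x * f (x + n) ≤ 0} ≤ ENNReal.ofReal ε), (η : ℝ≥0∞)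

/-- Robustness to adversarial perturbations: the `μ`-expectation of `deltaAdv f`. -/
def rhoAdv {d : ℕ} (μ : Measure (EuclideanSpace ℝ (Fin d)))
    (f : EuclideanSpace ℝ (Fin d) → ℝ) : ℝ≥0∞ :=
  ∫⁻ x, deltaAdv f x ∂μ

/-- `ε`-robustness to random uniform noise: the `μ`-expectation of `deltaUnif ε f`. -/
def rhoUnif {d : ℕ} (μ : Measure (EuclideanSpace ℝ (Fin d))) (ε : ℝ)
    (f : EuclideanSpace ℝ (Fin d) → ℝ) : ℝ≥0∞ :=
  ∫⁻ x, deltaUnif ε f x ∂μ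

/-- `C₁(ε) = (2 ln(2/ε))^{-1/2}`, with its limit value `0` at `ε = 0`. -/
def C₁ (ε : ℝ) : ℝ := if ε = 0 then 0 else (2 * Real.log (2 / ε)) ^ (-(1 / 2) : ℝ)

/-- `(1 - (12 ε)^{1/d})^{-1/2}`. -/
def C₂tilde (ε : ℝ) (d : ℕ) : ℝ := (1 - (12 * ε) ^ (1 / (d : ℝ))) ^ (-(1 / 2) : ℝ)

/-- `C₂(ε) = (1 - 12 ε)^{-1/2}`. -/
def C₂ (ε : ℝ) : ℝ := (1 - 12 * ε) ^ (-(1 / 2) : ℝ)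

end

end Robustness

/-!
For a linear classifier, `deltaAdv f x` is the distance `|f x| / ‖w‖` from `x` to the hyperplane
`f = 0`, and the noise on the sphere of radius `η` that flips the sign forms a spherical cap of
relative height `t = deltaAdv f x / η`. Everything therefore reduces to a two-sided estimate of the
normalized measure of that cap, which is the proportion of the unit ball taken up by the sector
over it. The sector lies in a ball of radius at most `exp (-t² / 2)`, so the measure is at most
`exp (-d t² / 2)`. Conversely, it contains the image of half of the unit ball under an affine map
that scales by `1 - t²` orthogonally to the axis and by `(1 - t²) / 6` along it, so the measure is
at least `(1 - t²)^d / 12`. Solving for `t` at level `ε` bounds `deltaUnif ε f x` pointwise by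
multiples of `deltaAdv f x`, and these bounds are integrated.
-/

namespace Robustness

open Metric Set
open scoped Pointwise

lemma rpow_neg_half (x : ℝ) : x ^ (-(1 / 2) : ℝ) = (√x)⁻¹ := by
  rw [Real.rpow_neg_eq_inv_rpow, ← Real.sqrt_eq_rpow, Real.sqrt_inv]

lemma inv_four_mul_le_exp_neg {s : ℝ} (h₀ : 1 / 2 ≤ s) (h₁ : s ≤ 1) :
    (4 * s)⁻¹ ≤ Real.exp (-s) := by
  rw [Real.exp_neg]
  gcongr
  calc Real.exp s = Real.exp 1 / Real.exp (1 - s) := by rw [← Real.exp_sub, sub_sub_cancel]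
    _ ≤ 3 / (2 - s) := by
        gcongr
        · linarith
        · exact Real.exp_one_lt_three.le
        · linarith [Real.add_one_le_exp (1 - s)]
    _ ≤ 4 * s := by
        rw [div_le_iff₀ (by linarith)]
        nlinarith

section SphericalCap

variable {E : Type*} [NormedAddCommGroup E] [InnerProductSpace ℝ E]

/-- The spherical cap of the unit sphere cut off by the half-space `{x | t ≤ ⟪u, x⟫}`. -/
def sphericalCap (u : E) (t : ℝ) : Set (sphere (0 : E) 1) := {n | t ≤ inner ℝ u (n : E)}

/-- The open spherical sector spanned by `sphericalCap u t`, without its apex. Its volume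
defines the surface measure of the cap, see `MeasureTheory.Measure.toSphere_apply'`. -/
def sphericalSector (u : E) (t : ℝ) : Set E := Ioo (0 : ℝ) 1 • ((↑) '' sphericalCap u t)

/-- The cap of the open unit ball cut off by the half-space `{x | t ≤ ⟪u, x⟫}`. -/
def ballCap (u : E) (t : ℝ) : Set E := {x ∈ ball 0 1 | t ≤ inner ℝ u x}

lemma sphericalCap_eq_empty {u : E} (hu : ‖u‖ = 1) {t : ℝ} (ht : 1 < t) :
    sphericalCap u t = ∅ := by
  refine eq_empty_of_forall_notMem fun n (hn : t ≤ inner ℝ u (n : E)) => ?_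
  have : inner ℝ u (n : E) ≤ 1 := by simpa [hu] using real_inner_le_norm u (n : E)
  linarith

lemma norm_smul_sub_smul_sq {u v : E} (hu : ‖u‖ = 1) (hv : ‖v‖ = 1) (r c : ℝ) :
    ‖r • v - c • u‖ ^ 2 = r ^ 2 - 2 * r * c * inner ℝ u v + c ^ 2 := by
  rw [norm_sub_sq_real, real_inner_smul_left, real_inner_smul_right, real_inner_comm, norm_smul,
    norm_smul, hu, hv, mul_one, mul_one, Real.norm_eq_abs, Real.norm_eq_abs, sq_abs, sq_abs]
  ring

lemma sphericalSector_subset_closedBall {u : E} (hu : ‖u‖ = 1) {t c ρ : ℝ} (hc : 0 ≤ c)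
    (hρ : 0 ≤ ρ) (h : ∀ r ∈ Ioo (0 : ℝ) 1, r ^ 2 - 2 * r * c * t + c ^ 2 ≤ ρ ^ 2) :
    sphericalSector u t ⊆ closedBall (c • u) ρ := by
  rintro _ ⟨r, hr, _, ⟨n, hn : t ≤ inner ℝ u (n : E), rfl⟩, rfl⟩
  rw [mem_closedBall_iff_norm]
  refine le_of_sq_le_sq ?_ hρ
  calc ‖r • (n : E) - c • u‖ ^ 2 = r ^ 2 - 2 * r * c * inner ℝ u (n : E) + c ^ 2 :=
        norm_smul_sub_smul_sq hu (norm_eq_of_mem_sphere n) r c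
    _ ≤ r ^ 2 - 2 * r * c * t + c ^ 2 := by
        have := hr.1.le
        gcongr
    _ ≤ ρ ^ 2 := h r hr

lemma exists_sphericalSector_subset_closedBall {u : E} (hu : ‖u‖ = 1) {t : ℝ} (ht₀ : 0 ≤ t)
    (ht₁ : t ≤ 1) :
    ∃ (c : E) (ρ : ℝ), 0 ≤ ρ ∧ ρ ^ 2 ≤ Real.exp (-t ^ 2) ∧
      sphericalSector u t ⊆ closedBall c ρ := by
  -- The smallest ball about `t • u` containing the cap reaches the apex `0` only if `t² ≤ 1 / 2`;
  -- for larger `t`, use the ball whose boundary passes through the apex and the rim of the cap.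
  rcases le_or_gt (t ^ 2) (1 / 2) with hflat | hsteep
  · have hsq : √(1 - t ^ 2) ^ 2 = 1 - t ^ 2 := Real.sq_sqrt (by linarith)
    refine ⟨t • u, √(1 - t ^ 2), Real.sqrt_nonneg _, ?_,
      sphericalSector_subset_closedBall hu ht₀ (Real.sqrt_nonneg _) fun r hr => ?_⟩
    · rw [hsq]
      linarith [Real.add_one_le_exp (-t ^ 2)]
    · rw [hsq]
      nlinarith [hr.1, hr.2]
  · have ht : 0 < t := ht₀.lt_of_ne (by rintro rfl; norm_num at hsteep)
    refine ⟨(2 * t)⁻¹ • u, (2 * t)⁻¹, by positivity, ?_,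
      sphericalSector_subset_closedBall hu (by positivity) (by positivity) fun r hr => ?_⟩
    · calc (2 * t)⁻¹ ^ 2 = (4 * t ^ 2)⁻¹ := by rw [inv_pow, mul_pow]; norm_num
        _ ≤ Real.exp (-t ^ 2) := inv_four_mul_le_exp_neg hsteep.le (pow_le_one₀ ht₀ ht₁)
    · have : 2 * r * (2 * t)⁻¹ * t = r := by field_simp
      nlinarith [hr.1, hr.2]

lemma ballCap_subset_sphericalSector (u : E) {t : ℝ} (ht : 0 < t) :
    ballCap u t ⊆ sphericalSector u t := by
  rintro x ⟨hx, hxt⟩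
  have hx₁ : ‖x‖ < 1 := mem_ball_zero_iff.1 hx
  have hx₀ : 0 < ‖x‖ := norm_pos_iff.2 (by rintro rfl; simp at hxt; linarith)
  refine ⟨‖x‖, ⟨hx₀, hx₁⟩, ‖x‖⁻¹ • x, ⟨⟨‖x‖⁻¹ • x, ?_⟩, ?_, rfl⟩, smul_inv_smul₀ hx₀.ne' x⟩
  · simp [norm_smul, hx₀.ne']
  · calc t ≤ inner ℝ u x := hxt
      _ ≤ ‖x‖⁻¹ * inner ℝ u x :=
          le_mul_of_one_le_left (ht.le.trans hxt) ((one_le_inv₀ hx₀).2 hx₁.le)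
      _ = inner ℝ u (‖x‖⁻¹ • x) := (real_inner_smul_right _ _ _).symm

/-- For a unit vector `u`, the linear map that scales by `κ` along `u` and fixes the orthogonal
complement of `u`. -/
noncomputable def axialScaling (u : E) (κ : ℝ) : E →ₗ[ℝ] E :=
  LinearMap.transvection ((κ - 1) • innerₛₗ ℝ u) u

lemma axialScaling_apply (u : E) (κ : ℝ) (x : E) :
    axialScaling u κ x = x + ((κ - 1) * inner ℝ u x) • u := rfl

lemma inner_axialScaling {u : E} (hu : ‖u‖ = 1) (κ : ℝ) (x : E) :
    inner ℝ u (axialScaling u κ x) = κ * inner ℝ u x := by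
  rw [axialScaling_apply, inner_add_right, real_inner_smul_right, real_inner_self_eq_norm_sq, hu]
  ring

lemma norm_axialScaling_sq {u : E} (hu : ‖u‖ = 1) (κ : ℝ) (x : E) :
    ‖axialScaling u κ x‖ ^ 2 = ‖x‖ ^ 2 - (1 - κ ^ 2) * inner ℝ u x ^ 2 := by
  rw [axialScaling_apply, norm_add_sq_real, real_inner_smul_right, real_inner_comm u x, norm_smul,
    hu, mul_one, Real.norm_eq_abs, sq_abs]
  ring

lemma norm_smul_add_smul_axialScaling_sq {u : E} (hu : ‖u‖ = 1) (t q κ : ℝ) (x : E) :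
    ‖t • u + q • axialScaling u κ x‖ ^ 2 =
      t ^ 2 + 2 * t * q * κ * inner ℝ u x +
        q ^ 2 * (‖x‖ ^ 2 - (1 - κ ^ 2) * inner ℝ u x ^ 2) := by
  rw [norm_add_sq_real, real_inner_smul_left, real_inner_smul_right, inner_axialScaling hu,
    norm_smul, norm_smul, hu, mul_pow, mul_pow, norm_axialScaling_sq hu, Real.norm_eq_abs,
    Real.norm_eq_abs, sq_abs, sq_abs]
  ring

lemma mapsTo_ballCap {u : E} (hu : ‖u‖ = 1) {t : ℝ} (ht₀ : 0 ≤ t) (ht₁ : t < 1) :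
    MapsTo (fun x => t • u + (1 - t ^ 2) • axialScaling u (1 / 6) x) (ballCap u 0)
      (ballCap u t) := by
  rintro x ⟨hx, hy₀ : 0 ≤ inner ℝ u x⟩
  have hx₁ : ‖x‖ < 1 := mem_ball_zero_iff.1 hx
  have hx₂ : ‖x‖ ^ 2 < 1 := pow_lt_one₀ (norm_nonneg x) hx₁ two_ne_zero
  have hy₁ : inner ℝ u x ≤ 1 := (real_inner_le_norm u x).trans (by rw [hu, one_mul]; exact hx₁.le)
  have hq : 0 < 1 - t ^ 2 := by nlinarith
  refine ⟨mem_ball_zero_iff.2 (lt_of_pow_lt_pow_left₀ 2 zero_le_one ?_), ?_⟩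
  · rw [norm_smul_add_smul_axialScaling_sq hu, one_pow]
    set y : ℝ := inner ℝ u x
    have hcross : t * y / 3 ≤ t ^ 2 + 35 / 36 * (1 - t ^ 2) * y ^ 2 := by
      rcases le_total y (3 * t) with h | h
      · nlinarith [mul_nonneg ht₀ (sub_nonneg.2 h), mul_nonneg hq.le (sq_nonneg y)]
      · have hflat : 8 / 9 ≤ 1 - t ^ 2 := by nlinarith
        nlinarith [mul_nonneg hy₀ (sub_nonneg.2 h),
          mul_nonneg (sub_nonneg.2 hflat) (sq_nonneg y)]
    nlinarith [mul_le_mul_of_nonneg_left hcross hq.le, mul_lt_mul_of_pos_left hx₂ (pow_pos hq 2)]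
  · change t ≤ inner ℝ u (t • u + (1 - t ^ 2) • axialScaling u (1 / 6) x)
    rw [inner_add_right, real_inner_smul_right, real_inner_smul_right, inner_axialScaling hu,
      real_inner_self_eq_norm_sq, hu, one_pow, mul_one]
    exact le_add_of_nonneg_right (by positivity)

lemma measurableSet_sphericalCap [MeasurableSpace E] [OpensMeasurableSpace E] (u : E) (t : ℝ) :
    MeasurableSet (sphericalCap u t) :=
  (isClosed_le continuous_const (by fun_prop)).measurableSet

variable [FiniteDimensional ℝ E]

lemma det_axialScaling {u : E} (hu : ‖u‖ = 1) (κ : ℝ) :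
    LinearMap.det (axialScaling u κ) = κ := by
  simp [axialScaling, LinearMap.transvection.det, hu]

variable [MeasurableSpace E] [BorelSpace E] (ν : Measure E) [ν.IsAddHaarMeasure]

lemma measure_ball_le_two_mul_ballCap (u : E) : ν (ball 0 1) ≤ 2 * ν (ballCap u 0) := by
  have hcover : ball (0 : E) 1 ⊆ ballCap u 0 ∪ -ballCap u 0 := fun x hx =>
    (le_total 0 (inner ℝ u x)).imp (fun h => ⟨hx, h⟩)
      fun h => ⟨by simpa using hx, by simpa using h⟩
  calc ν (ball 0 1) ≤ ν (ballCap u 0) + ν (-ballCap u 0) :=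
        (measure_mono hcover).trans (measure_union_le _ _)
    _ = 2 * ν (ballCap u 0) := by rw [Measure.measure_neg, two_mul]

lemma le_measure_ballCap {u : E} (hu : ‖u‖ = 1) {t : ℝ} (ht₀ : 0 ≤ t) (ht₁ : t < 1) :
    ENNReal.ofReal ((1 - t ^ 2) ^ Module.finrank ℝ E / 12) * ν (ball 0 1) ≤ ν (ballCap u t) := by
  set q := 1 - t ^ 2
  have hq : 0 < q := by simp only [q]; nlinarith
  let T : E →ₗ[ℝ] E := q • axialScaling u (1 / 6)
  have hdet : |LinearMap.det T| = q ^ Module.finrank ℝ E / 6 := by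
    rw [LinearMap.det_smul, det_axialScaling hu, abs_of_pos (by positivity)]
    ring
  calc ENNReal.ofReal (q ^ Module.finrank ℝ E / 12) * ν (ball 0 1)
      ≤ ENNReal.ofReal (q ^ Module.finrank ℝ E / 12) * (2 * ν (ballCap u 0)) := by
        gcongr
        exact measure_ball_le_two_mul_ballCap ν u
    _ = ENNReal.ofReal |LinearMap.det T| * ν (ballCap u 0) := by
        rw [hdet, ← mul_assoc, ← ENNReal.ofReal_ofNat 2, ← ENNReal.ofReal_mul (by positivity)]
        ring_nf
    _ = ν ((t • u + ·) '' (T '' ballCap u 0)) := by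
        rw [← Measure.addHaar_image_linearMap, image_add_left, measure_preimage_add]
    _ ≤ ν (ballCap u t) := by
        rw [image_image]
        exact measure_mono (mapsTo_ballCap hu ht₀ ht₁).image_subset

lemma toSphere_sphericalCap_le {u : E} (hu : ‖u‖ = 1) {t : ℝ} (ht : 0 ≤ t) :
    ν.toSphere (sphericalCap u t) ≤
      ENNReal.ofReal (Real.exp (-(Module.finrank ℝ E * t ^ 2 / 2))) * ν.toSphere univ := by
  rcases lt_or_ge 1 t with ht₁ | ht₁
  · simp [sphericalCap_eq_empty hu ht₁]
  obtain ⟨c, ρ, hρ₀, hρ, hsub⟩ := exists_sphericalSector_subset_closedBall hu ht ht₁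
  have hpow : ρ ^ Module.finrank ℝ E ≤ Real.exp (-(Module.finrank ℝ E * t ^ 2 / 2)) := by
    refine le_of_sq_le_sq ?_ (Real.exp_pos _).le
    calc (ρ ^ Module.finrank ℝ E) ^ 2 = (ρ ^ 2) ^ Module.finrank ℝ E := pow_right_comm ..
      _ ≤ Real.exp (-t ^ 2) ^ Module.finrank ℝ E := by gcongr
      _ = Real.exp (-(Module.finrank ℝ E * t ^ 2 / 2)) ^ 2 := by
          rw [← Real.exp_nat_mul, ← Real.exp_nat_mul]
          push_cast
          ring_nf
  calc ν.toSphere (sphericalCap u t) = Module.finrank ℝ E * ν (sphericalSector u t) :=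
        ν.toSphere_apply' (measurableSet_sphericalCap u t)
    _ ≤ Module.finrank ℝ E * (ENNReal.ofReal (ρ ^ Module.finrank ℝ E) * ν (ball 0 1)) := by
        rw [← Measure.addHaar_closedBall ν c hρ₀]
        gcongr
    _ ≤ ENNReal.ofReal (Real.exp (-(Module.finrank ℝ E * t ^ 2 / 2))) * ν.toSphere univ := by
        rw [Measure.toSphere_apply_univ, mul_left_comm]
        gcongr

lemma le_toSphere_sphericalCap {u : E} (hu : ‖u‖ = 1) {t : ℝ} (ht₀ : 0 < t) (ht₁ : t < 1) :
    ENNReal.ofReal ((1 - t ^ 2) ^ Module.finrank ℝ E / 12) * ν.toSphere univ ≤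
      ν.toSphere (sphericalCap u t) := by
  rw [ν.toSphere_apply' (measurableSet_sphericalCap u t), Measure.toSphere_apply_univ,
    mul_left_comm]
  gcongr
  exact (le_measure_ballCap ν hu ht₀.le ht₁).trans
    (measure_mono (ballCap_subset_sphericalSector u ht₀))

end SphericalCap

section UniformSphere

instance isNegInvariant_toSphere {E : Type*} [NormedAddCommGroup E] [NormedSpace ℝ E]
    [MeasurableSpace E] [BorelSpace E] (ν : Measure E) [ν.IsNegInvariant] :
    ν.toSphere.IsNegInvariant where
  neg_eq_self := by
    ext s hs
    have hneg : Ioo (0 : ℝ) 1 • ((↑) '' (Neg.neg ⁻¹' s) : Set E) =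
        -(Ioo (0 : ℝ) 1 • ((↑) '' s)) := by
      apply Subset.antisymm
      · rintro _ ⟨r, hr, _, ⟨n, hn, rfl⟩, rfl⟩
        exact ⟨r, hr, _, ⟨-n, hn, rfl⟩, by simp [smul_neg]⟩
      · rintro x ⟨r, hr, _, ⟨n, hn, rfl⟩, hx⟩
        exact ⟨r, hr, _, ⟨-n, by simpa using hn, rfl⟩,
          by simpa [smul_neg, neg_eq_iff_eq_neg] using hx⟩
    rw [Measure.neg, Measure.map_apply measurable_neg hs, ν.toSphere_apply' (measurable_neg hs),
      ν.toSphere_apply' hs, hneg, Measure.measure_neg]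

variable {d : ℕ}

lemma measurable_smul_sphere (η : ℝ≥0) :
    Measurable fun n : sphere (0 : EuclideanSpace ℝ (Fin d)) 1 =>
      (η : ℝ) • (n : EuclideanSpace ℝ (Fin d)) := by
  fun_prop

lemma isProbabilityMeasure_uniformSphere (hd : 1 ≤ d) (η : ℝ≥0) :
    IsProbabilityMeasure (uniformSphere d η) := by
  have : Nonempty (Fin d) := ⟨⟨0, hd⟩⟩
  have : IsProbabilityMeasure
      (((volume : Measure (EuclideanSpace ℝ (Fin d))).toSphere univ)⁻¹ •
        (volume : Measure (EuclideanSpace ℝ (Fin d))).toSphere) := by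
    have : NeZero (volume : Measure (EuclideanSpace ℝ (Fin d))).toSphere :=
      ⟨Measure.toSphere_ne_zero _⟩
    infer_instance
  exact Measure.isProbabilityMeasure_map (measurable_smul_sphere η).aemeasurable

instance isNegInvariant_uniformSphere (η : ℝ≥0) : (uniformSphere d η).IsNegInvariant where
  neg_eq_self := by
    have hcomm : Neg.neg ∘ (fun n : sphere (0 : EuclideanSpace ℝ (Fin d)) 1 =>
          (η : ℝ) • (n : EuclideanSpace ℝ (Fin d))) =
        (fun n : sphere (0 : EuclideanSpace ℝ (Fin d)) 1 =>
          (η : ℝ) • (n : EuclideanSpace ℝ (Fin d))) ∘ Neg.neg := by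
      ext1 n
      simp [smul_neg]
    change (uniformSphere d η).map Neg.neg = _
    rw [uniformSphere, Measure.map_map measurable_neg (measurable_smul_sphere η), hcomm,
      ← Measure.map_map (measurable_smul_sphere η) measurable_neg, Measure.map_smul,
      Measure.map_neg_eq_self]

lemma ae_uniformSphere_norm_eq (η : ℝ≥0) : ∀ᵐ n ∂uniformSphere d η, ‖n‖ = η := by
  refine (ae_map_iff (measurable_smul_sphere η).aemeasurable
    (measurableSet_eq_fun measurable_norm measurable_const)).2 (.of_forall fun n => ?_)
  simp [norm_smul]

lemma uniformSphere_le_inner_neg (η : ℝ≥0) (w : EuclideanSpace ℝ (Fin d)) (c : ℝ) :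
    uniformSphere d η {n | c ≤ inner ℝ (-w) n} = uniformSphere d η {n | c ≤ inner ℝ w n} := by
  rw [← Measure.measure_neg]
  simp

variable {w : EuclideanSpace ℝ (Fin d)} {η : ℝ≥0} {c : ℝ}

lemma uniformSphere_halfSpace (hw : w ≠ 0) (hη : 0 < η) (c : ℝ) :
    uniformSphere d η {n | c ≤ inner ℝ w n} =
      ((volume : Measure (EuclideanSpace ℝ (Fin d))).toSphere univ)⁻¹ *
        (volume : Measure (EuclideanSpace ℝ (Fin d))).toSphere
          (sphericalCap (‖w‖⁻¹ • w) (c / (‖w‖ * η))) := by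
  have : 0 < ‖w‖ := norm_pos_iff.2 hw
  have hcap : (fun n : sphere (0 : EuclideanSpace ℝ (Fin d)) 1 =>
      (η : ℝ) • (n : EuclideanSpace ℝ (Fin d))) ⁻¹' {n | c ≤ inner ℝ w n} =
        sphericalCap (‖w‖⁻¹ • w) (c / (‖w‖ * η)) := by
    ext n
    change c ≤ inner ℝ w ((η : ℝ) • (n : EuclideanSpace ℝ (Fin d))) ↔
      c / (‖w‖ * η) ≤ inner ℝ (‖w‖⁻¹ • w) (n : EuclideanSpace ℝ (Fin d))
    rw [real_inner_smul_right, real_inner_smul_left, div_le_iff₀ (by positivity)]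
    field_simp
  rw [uniformSphere, Measure.map_apply (measurable_smul_sphere η)
    (measurableSet_le measurable_const (by fun_prop)), hcap, Measure.smul_apply, smul_eq_mul]

lemma uniformSphere_halfSpace_le (hw : w ≠ 0) (hη : 0 < η) (hc : 0 ≤ c) :
    uniformSphere d η {n | c ≤ inner ℝ w n} ≤
      ENNReal.ofReal (Real.exp (-(d * (c / (‖w‖ * η)) ^ 2 / 2))) := by
  have hu : ‖‖w‖⁻¹ • w‖ = 1 := by simp [norm_smul, hw]
  have hcap := toSphere_sphericalCap_le volume hu (t := c / (‖w‖ * η)) (by positivity)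
  rw [finrank_euclideanSpace_fin] at hcap
  rw [uniformSphere_halfSpace hw hη, mul_comm, ← div_eq_mul_inv]
  exact ENNReal.div_le_of_le_mul hcap

lemma le_uniformSphere_halfSpace (hc : 0 < c) (hcw : c < ‖w‖ * η) :
    ENNReal.ofReal ((1 - (c / (‖w‖ * η)) ^ 2) ^ d / 12) ≤
      uniformSphere d η {n | c ≤ inner ℝ w n} := by
  have hηw : 0 < ‖w‖ * η := hc.trans hcw
  have hw : w ≠ 0 := by rintro rfl; simp at hηw
  have hη : (0 : ℝ) < η := pos_of_mul_pos_right hηw (norm_nonneg w)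
  have hu : ‖‖w‖⁻¹ • w‖ = 1 := by simp [norm_smul, hw]
  have hcap := le_toSphere_sphericalCap volume hu (div_pos hc hηw) ((div_lt_one hηw).2 hcw)
  rw [finrank_euclideanSpace_fin] at hcap
  rw [uniformSphere_halfSpace hw hη, mul_comm (_⁻¹), ← div_eq_mul_inv]
  have : Nontrivial (EuclideanSpace ℝ (Fin d)) := ⟨w, 0, hw⟩
  exact (ENNReal.le_div_iff_mul_le (.inl (Measure.measure_univ_ne_zero.2
    (Measure.toSphere_ne_zero _))) (.inl (measure_ne_top _ _))).2 hcap

end UniformSphere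

section Deltas

variable {d : ℕ} {f : EuclideanSpace ℝ (Fin d) → ℝ} {x : EuclideanSpace ℝ (Fin d)} {ε : ℝ}

lemma deltaAdv_of_eq_zero (hx : f x = 0) : deltaAdv f x = 0 :=
  le_antisymm (iInf₂_le_of_le 0 (by simp [hx]) (by simp)) zero_le

lemma deltaUnif_of_eq_zero (hd : 1 ≤ d) (hε : ε < 1) (hx : f x = 0) : deltaUnif ε f x = 0 := by
  have := isProbabilityMeasure_uniformSphere hd
  simp [deltaUnif, hx, hε.not_ge]

lemma deltaAdv_le_deltaUnif (ε : ℝ) (f : EuclideanSpace ℝ (Fin d) → ℝ)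
    (x : EuclideanSpace ℝ (Fin d)) : deltaAdv f x ≤ deltaUnif ε f x := by
  refine ENNReal.le_of_forall_nnreal_lt fun η hη => le_iSup₂_of_le η ?_ le_rfl
  have hnull : uniformSphere d η {n | f x * f (x + n) ≤ 0} = 0 := by
    refine measure_eq_zero_iff_ae_notMem.2 ?_
    filter_upwards [ae_uniformSphere_norm_eq η] with n hn hflip
    have hle : deltaAdv f x ≤ ‖n‖ₑ := iInf₂_le n hflip
    rw [← ofReal_norm, hn, ENNReal.ofReal_coe_nnreal] at hle
    exact hη.not_ge hle
  simp [hnull]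

end Deltas

section Constants

variable {d : ℕ} {ε : ℝ}

lemma exp_neg_inv_C₁_sq_le (hε : 0 ≤ ε) (hC : 0 < C₁ ε * √d) :
    Real.exp (-(d * (C₁ ε * √d)⁻¹ ^ 2 / 2)) ≤ ε := by
  have hε' : ε ≠ 0 := by rintro rfl; simp [C₁] at hC
  rw [C₁, if_neg hε', rpow_neg_half] at hC ⊢
  set L := Real.log (2 / ε)
  have hL : 0 < 2 * L := Real.sqrt_pos.1 (inv_pos.1 (pos_of_mul_pos_left hC (Real.sqrt_nonneg _)))
  have hd : (0 : ℝ) < d := Real.sqrt_pos.1 (pos_of_mul_pos_right hC (by positivity))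
  have hexp : d * ((√(2 * L))⁻¹ * √d)⁻¹ ^ 2 / 2 = L := by
    rw [mul_inv, inv_inv, mul_pow, inv_pow, Real.sq_sqrt hL.le, Real.sq_sqrt hd.le]
    field_simp
  rw [hexp, Real.exp_neg, Real.exp_log (by positivity), inv_div]
  linarith

lemma rpow_one_div_lt_one (hd : 1 ≤ d) (hε₀ : 0 ≤ ε) (hε₁ : ε < 1 / 12) :
    (12 * ε) ^ (1 / (d : ℝ)) < 1 :=
  Real.rpow_lt_one (by positivity) (by linarith) (by positivity)

lemma one_le_C₂tilde (hd : 1 ≤ d) (hε₀ : 0 ≤ ε) (hε₁ : ε < 1 / 12) : 1 ≤ C₂tilde ε d :=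
  Real.one_le_rpow_of_pos_of_le_one_of_nonpos (sub_pos.2 (rpow_one_div_lt_one hd hε₀ hε₁))
    (sub_le_self _ (by positivity)) (by norm_num)

lemma rpow_one_div_pow (hd : 1 ≤ d) (hε : 0 ≤ ε) : ((12 * ε) ^ (1 / (d : ℝ))) ^ d = 12 * ε := by
  rw [one_div, Real.rpow_inv_natCast_pow (by positivity) (by positivity)]

lemma C₂tilde_le (hd : 1 ≤ d) (hε₀ : 0 ≤ ε) (hε₁ : ε < 1 / 12) : C₂tilde ε d ≤ C₂ ε * √d := by
  set A := (12 * ε) ^ (1 / (d : ℝ))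
  have hA : A < 1 := rpow_one_div_lt_one hd hε₀ hε₁
  have hbernoulli : 1 - 12 * ε ≤ d * (1 - A) := by
    have := one_add_mul_le_pow (a := A - 1) (by linarith [show 0 ≤ A by positivity]) d
    rw [add_sub_cancel, rpow_one_div_pow hd hε₀] at this
    linarith
  have hA₀ : 0 < √(1 - A) := Real.sqrt_pos.2 (sub_pos.2 hA)
  have hε : 0 < √(1 - 12 * ε) := Real.sqrt_pos.2 (by linarith)
  rw [C₂tilde, C₂, rpow_neg_half, rpow_neg_half, inv_mul_eq_div, inv_eq_one_div,
    div_le_div_iff₀ hA₀ hε, one_mul, ← Real.sqrt_mul (Nat.cast_nonneg d)]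
  exact Real.sqrt_le_sqrt hbernoulli

lemma twelve_mul_lt_one_sub_sq_pow (hd : 1 ≤ d) (hε₀ : 0 ≤ ε) (hε₁ : ε < 1 / 12) {t : ℝ}
    (ht : 0 ≤ t) (h : C₂tilde ε d * t < 1) : 12 * ε < (1 - t ^ 2) ^ d := by
  set A := (12 * ε) ^ (1 / (d : ℝ))
  have hA : A < 1 - t ^ 2 := by
    have hA₀ : 0 < √(1 - A) := Real.sqrt_pos.2 (sub_pos.2 (rpow_one_div_lt_one hd hε₀ hε₁))
    rw [C₂tilde, rpow_neg_half, inv_mul_lt_one₀ hA₀, Real.lt_sqrt ht] at h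
    linarith
  calc 12 * ε = A ^ d := (rpow_one_div_pow hd hε₀).symm
    _ < (1 - t ^ 2) ^ d := pow_lt_pow_left₀ hA (by positivity) (by lia)

end Constants

section LinearClassifier

variable {d : ℕ} {w : EuclideanSpace ℝ (Fin d)} {b ε : ℝ}

lemma linearClassifier_add (w : EuclideanSpace ℝ (Fin d)) (b : ℝ)
    (x n : EuclideanSpace ℝ (Fin d)) :
    linearClassifier w b (x + n) = linearClassifier w b x + inner ℝ w n := by
  rw [linearClassifier, linearClassifier, inner_add_right, add_right_comm]

@[fun_prop]
lemma continuous_linearClassifier (w : EuclideanSpace ℝ (Fin d)) (b : ℝ) :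
    Continuous (linearClassifier w b) := by
  unfold linearClassifier
  fun_prop

lemma deltaAdv_linearClassifier (w : EuclideanSpace ℝ (Fin d)) (b : ℝ)
    (x : EuclideanSpace ℝ (Fin d)) :
    deltaAdv (linearClassifier w b) x = ‖linearClassifier w b x‖ₑ / ‖w‖ₑ := by
  set y := linearClassifier w b x with hy
  apply le_antisymm
  · rcases eq_or_ne y 0 with hy₀ | hy₀
    · simp [deltaAdv_of_eq_zero (f := linearClassifier w b) hy₀]
    rcases eq_or_ne w 0 with rfl | hw
    · simp [ENNReal.div_zero, hy₀]
    have hw' : ‖w‖ ≠ 0 := norm_ne_zero_iff.2 hw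
    refine iInf₂_le_of_le (-(y / ‖w‖ ^ 2) • w) ?_ (le_of_eq ?_)
    · rw [linearClassifier_add, real_inner_smul_right, real_inner_self_eq_norm_sq, neg_mul,
        div_mul_cancel₀ _ (pow_ne_zero 2 hw'), ← hy, add_neg_cancel, mul_zero]
    · rw [← ofReal_norm, norm_smul, norm_neg, norm_div, norm_pow, norm_norm, pow_two,
        ← div_div, div_mul_cancel₀ _ hw', ENNReal.ofReal_div_of_pos (by positivity), ofReal_norm,
        ofReal_norm]
  · refine le_iInf₂ fun r hr => ENNReal.div_le_of_le_mul' ?_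
    rw [linearClassifier_add, ← hy] at hr
    have habs : |y| ≤ |inner ℝ w r| := sq_le_sq.1 (by nlinarith [sq_nonneg (y + inner ℝ w r)])
    rw [← enorm_norm w, ← enorm_norm r, ← enorm_mul, enorm_le_iff_norm_le, norm_mul, norm_norm,
      norm_norm]
    exact habs.trans (abs_real_inner_le_norm w r)

lemma measurable_deltaAdv_linearClassifier (w : EuclideanSpace ℝ (Fin d)) (b : ℝ) :
    Measurable (deltaAdv (linearClassifier w b)) := by
  simp_rw [funext (deltaAdv_linearClassifier w b)]
  fun_prop

lemma rhoAdv_linearClassifier_lt_top {μ : Measure (EuclideanSpace ℝ (Fin d))} (hw : w ≠ 0)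
    (hint : Integrable (linearClassifier w b) μ) : rhoAdv μ (linearClassifier w b) < ⊤ := by
  simp_rw [rhoAdv, deltaAdv_linearClassifier, div_eq_mul_inv]
  rw [lintegral_mul_const _ (by fun_prop)]
  exact ENNReal.mul_lt_top hint.2 (by simpa using hw)

lemma integrable_linearClassifier {μ : Measure (EuclideanSpace ℝ (Fin d))} [IsFiniteMeasure μ]
    {M : ℝ} (hM : ∀ᵐ x ∂μ, ‖x‖ ≤ M) (w : EuclideanSpace ℝ (Fin d)) (b : ℝ) :
    Integrable (linearClassifier w b) μ := by
  refine .of_bound (C := ‖w‖ * M + |b|) (by fun_prop) ?_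
  filter_upwards [hM] with x hx
  calc ‖inner ℝ w x + b‖ ≤ ‖inner ℝ w x‖ + ‖b‖ := norm_add_le _ _
    _ ≤ ‖w‖ * M + |b| := by
        gcongr
        · exact (norm_inner_le_norm w x).trans (by gcongr)
        · exact le_rfl

lemma uniformSphere_flip (η : ℝ≥0) {x : EuclideanSpace ℝ (Fin d)}
    (hx : linearClassifier w b x ≠ 0) :
    uniformSphere d η {n | linearClassifier w b x * linearClassifier w b (x + n) ≤ 0} =
      uniformSphere d η {n | |linearClassifier w b x| ≤ inner ℝ w n} := by
  simp_rw [linearClassifier_add]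
  rcases hx.lt_or_gt with hneg | hpos
  · congr! 3 with n
    rw [abs_of_neg hneg, neg_le_iff_add_nonneg', mul_nonpos_iff]
    grind
  · rw [← uniformSphere_le_inner_neg]
    congr! 3 with n
    rw [abs_of_pos hpos, inner_neg_left, le_neg_iff_add_nonpos_left, mul_nonpos_iff]
    grind

/-- The largest radius `η` for which the uniform distribution on the sphere of radius `η` gives
mass at most `ε` to the half-space `{n | c ≤ ⟪w, n⟫}`, as a supremum in `[0, ∞]`. For `0 < c`, this
is `deltaUnif` for a linear classifier with weight vector `w` at a point where it takes the value
`c` or `-c`; being monotone in `c`, it makes `deltaUnif` measurable. -/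
noncomputable def capRadius (ε : ℝ) (w : EuclideanSpace ℝ (Fin d)) (c : ℝ) : ℝ≥0∞ :=
  ⨆ (η : ℝ≥0) (_ : uniformSphere d η {n | c ≤ inner ℝ w n} ≤ ENNReal.ofReal ε), (η : ℝ≥0∞)

lemma capRadius_mono (ε : ℝ) (w : EuclideanSpace ℝ (Fin d)) : Monotone (capRadius ε w) :=
  fun _ _ hc => iSup₂_mono' fun η hη =>
    ⟨η, (measure_mono fun _ hn => hc.trans hn).trans hη, le_rfl⟩

lemma deltaUnif_eq_capRadius (ε : ℝ) {x : EuclideanSpace ℝ (Fin d)}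
    (hx : linearClassifier w b x ≠ 0) :
    deltaUnif ε (linearClassifier w b) x = capRadius ε w |linearClassifier w b x| := by
  simp_rw [deltaUnif, capRadius, uniformSphere_flip _ hx]

lemma measurable_deltaUnif_linearClassifier (hd : 1 ≤ d) (hε : ε < 1)
    (w : EuclideanSpace ℝ (Fin d)) (b : ℝ) :
    Measurable (deltaUnif ε (linearClassifier w b)) := by
  have hite : deltaUnif ε (linearClassifier w b) = fun x =>
      if linearClassifier w b x = 0 then 0 else capRadius ε w |linearClassifier w b x| := by
    ext1 x
    split_ifs with hx
    · exact deltaUnif_of_eq_zero hd hε hx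
    · exact deltaUnif_eq_capRadius ε hx
  rw [hite]
  refine Measurable.ite (measurableSet_eq_fun (by fun_prop) measurable_const) measurable_const ?_
  exact (capRadius_mono ε w).measurable.comp (by fun_prop)

lemma capRadius_zero (ε : ℝ) {c : ℝ} (hc : 0 < c) :
    capRadius ε (0 : EuclideanSpace ℝ (Fin d)) c = ⊤ :=
  ENNReal.eq_top_of_forall_nnreal_le fun η => le_iSup₂_of_le η (by simp [hc.not_ge]) le_rfl

lemma le_capRadius (hε : 0 ≤ ε) (w : EuclideanSpace ℝ (Fin d)) {c : ℝ} (hc : 0 < c) :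
    ENNReal.ofReal (C₁ ε * √d) * (ENNReal.ofReal c / ‖w‖ₑ) ≤ capRadius ε w c := by
  rcases eq_or_ne w 0 with rfl | hw
  · simp [capRadius_zero ε hc]
  have hw₀ : 0 < ‖w‖ := norm_pos_iff.2 hw
  rcases le_or_gt (C₁ ε * √d) 0 with hk | hk
  · simp [ENNReal.ofReal_of_nonpos hk]
  have hη : 0 < C₁ ε * √d * (c / ‖w‖) := by positivity
  rw [← ofReal_norm, ← ENNReal.ofReal_div_of_pos hw₀, ← ENNReal.ofReal_mul hk.le]
  refine le_iSup₂_of_le (Real.toNNReal _) ?_ le_rfl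
  refine (uniformSphere_halfSpace_le hw (Real.toNNReal_pos.2 hη) hc.le).trans ?_
  have ht : c / (‖w‖ * (C₁ ε * √d * (c / ‖w‖))) = (C₁ ε * √d)⁻¹ := by
    field_simp
  rw [Real.coe_toNNReal _ hη.le, ht]
  exact ENNReal.ofReal_le_ofReal (exp_neg_inv_C₁_sq_le hε hk)

lemma C₁_mul_deltaAdv_le_deltaUnif (hε : 0 ≤ ε) (w x : EuclideanSpace ℝ (Fin d)) (b : ℝ) :
    ENNReal.ofReal (C₁ ε * √d) * deltaAdv (linearClassifier w b) x ≤
      deltaUnif ε (linearClassifier w b) x := by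
  by_cases hx : linearClassifier w b x = 0
  · simp [deltaAdv_of_eq_zero hx]
  · rw [deltaAdv_linearClassifier, deltaUnif_eq_capRadius ε hx, Real.enorm_eq_ofReal_abs]
    exact le_capRadius hε w (abs_pos.2 hx)

lemma max_mul_deltaAdv_le_deltaUnif (hε : 0 ≤ ε) (w x : EuclideanSpace ℝ (Fin d)) (b : ℝ) :
    ENNReal.ofReal (max (C₁ ε * √d) 1) * deltaAdv (linearClassifier w b) x ≤
      deltaUnif ε (linearClassifier w b) x := by
  rcases max_choice (C₁ ε * √d) 1 with hmax | hmax
  · rw [hmax]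
    exact C₁_mul_deltaAdv_le_deltaUnif hε w x b
  · rw [hmax, ENNReal.ofReal_one, one_mul]
    exact deltaAdv_le_deltaUnif ε _ x

lemma capRadius_le (hd : 1 ≤ d) (hε₀ : 0 ≤ ε) (hε₁ : ε < 1 / 12) (w : EuclideanSpace ℝ (Fin d))
    {c : ℝ} (hc : 0 < c) :
    capRadius ε w c ≤ ENNReal.ofReal (C₂tilde ε d) * (ENNReal.ofReal c / ‖w‖ₑ) := by
  have hC₁ := one_le_C₂tilde hd hε₀ hε₁
  have hC : 0 < C₂tilde ε d := zero_lt_one.trans_le hC₁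
  rcases eq_or_ne w 0 with rfl | hw
  · simp [ENNReal.div_zero, hc, hC, ENNReal.mul_top]
  have hw₀ : 0 < ‖w‖ := norm_pos_iff.2 hw
  rw [← ofReal_norm, ← ENNReal.ofReal_div_of_pos hw₀, ← ENNReal.ofReal_mul hC.le]
  refine iSup₂_le fun η hη => le_of_not_gt fun hlt => hη.not_gt ?_
  have hCη : C₂tilde ε d * (c / ‖w‖) < η := by
    rwa [← ENNReal.ofReal_coe_nnreal, ENNReal.ofReal_lt_ofReal_iff_of_nonneg (by positivity)] at hlt
  have hcη : c < ‖w‖ * η := by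
    rw [← div_lt_iff₀' hw₀]
    exact (le_mul_of_one_le_left (by positivity) hC₁).trans_lt hCη
  have hη₀ : (0 : ℝ) < η := pos_of_mul_pos_right (hc.trans hcη) hw₀.le
  have hpow : 12 * ε < (1 - (c / (‖w‖ * η)) ^ 2) ^ d := by
    refine twelve_mul_lt_one_sub_sq_pow hd hε₀ hε₁ (by positivity) ?_
    rwa [← div_div, ← mul_div_assoc, div_lt_one hη₀]
  calc ENNReal.ofReal ε < ENNReal.ofReal ((1 - (c / (‖w‖ * η)) ^ 2) ^ d / 12) :=
        (ENNReal.ofReal_lt_ofReal_iff_of_nonneg hε₀).2 (by linarith)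
    _ ≤ uniformSphere d η {n | c ≤ inner ℝ w n} := le_uniformSphere_halfSpace hc hcη

lemma deltaUnif_le_C₂tilde_mul_deltaAdv (hd : 1 ≤ d) (hε₀ : 0 ≤ ε) (hε₁ : ε < 1 / 12)
    (w x : EuclideanSpace ℝ (Fin d)) (b : ℝ) :
    deltaUnif ε (linearClassifier w b) x ≤
      ENNReal.ofReal (C₂tilde ε d) * deltaAdv (linearClassifier w b) x := by
  by_cases hx : linearClassifier w b x = 0
  · simp [deltaUnif_of_eq_zero hd (hε₁.trans (by norm_num)) hx]
  · rw [deltaAdv_linearClassifier, deltaUnif_eq_capRadius ε hx, Real.enorm_eq_ofReal_abs]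
    exact capRadius_le hd hε₀ hε₁ w (abs_pos.2 hx)

end LinearClassifier

end Robustness

open Robustness in
theorem theorem2_general (d : ℕ) (hd : 1 ≤ d) (μ : Measure (EuclideanSpace ℝ (Fin d)))
    (w : EuclideanSpace ℝ (Fin d)) (b : ℝ) (ε : ℝ) (hε₀ : 0 ≤ ε) (hε₁ : ε < 1 / 12) :
    Measurable (deltaAdv (linearClassifier w b)) ∧
    Measurable (deltaUnif ε (linearClassifier w b)) ∧
    (w ≠ 0 → Integrable (linearClassifier w b) μ →
      rhoAdv μ (linearClassifier w b) < ⊤ ∧ rhoUnif μ ε (linearClassifier w b) < ⊤) ∧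
    ENNReal.ofReal (max (C₁ ε * √(d : ℝ)) 1) * rhoAdv μ (linearClassifier w b)
      ≤ rhoUnif μ ε (linearClassifier w b) ∧
    rhoUnif μ ε (linearClassifier w b)
      ≤ ENNReal.ofReal (C₂tilde ε d) * rhoAdv μ (linearClassifier w b) ∧
    ENNReal.ofReal (C₂tilde ε d) * rhoAdv μ (linearClassifier w b)
      ≤ ENNReal.ofReal (C₂ ε * √(d : ℝ)) * rhoAdv μ (linearClassifier w b) := by
  have hmeas := measurable_deltaAdv_linearClassifier w b
  have hupper : rhoUnif μ ε (linearClassifier w b) ≤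
      ENNReal.ofReal (C₂tilde ε d) * rhoAdv μ (linearClassifier w b) := by
    rw [rhoAdv, ← lintegral_const_mul _ hmeas]
    exact lintegral_mono fun x => deltaUnif_le_C₂tilde_mul_deltaAdv hd hε₀ hε₁ w x b
  refine ⟨hmeas, measurable_deltaUnif_linearClassifier hd (hε₁.trans (by norm_num)) w b,
    fun hw hint => ?_, ?_, hupper, ?_⟩
  · have hadv := rhoAdv_linearClassifier_lt_top hw hint
    exact ⟨hadv, hupper.trans_lt (ENNReal.mul_lt_top ENNReal.ofReal_lt_top hadv)⟩
  · rw [rhoAdv, ← lintegral_const_mul _ hmeas]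
    exact lintegral_mono fun x => max_mul_deltaAdv_le_deltaUnif hε₀ w x b
  · gcongr
    exact C₂tilde_le hd hε₀ hε₁

theorem theorem2 (d : ℕ) (hd : 1 ≤ d)
    (μ : MeasureTheory.Measure (EuclideanSpace ℝ (Fin d))) [MeasureTheory.IsProbabilityMeasure μ]
    (w : EuclideanSpace ℝ (Fin d)) (b : ℝ) (ε : ℝ) (hε₀ : 0 ≤ ε) (hε₁ : ε < 1 / 12) :
    -- the two expectations are expectations of measurable functions
    Measurable (Robustness.deltaAdv (Robustness.linearClassifier w b)) ∧
    Measurable (Robustness.deltaUnif ε (Robustness.linearClassifier w b)) ∧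
    -- they are finite for a nonconstant classifier and data of bounded support
    (w ≠ 0 → (∃ M : ℝ, ∀ᵐ x ∂μ, ‖x‖ ≤ M) →
      Robustness.rhoAdv μ (Robustness.linearClassifier w b) < ⊤ ∧
      Robustness.rhoUnif μ ε (Robustness.linearClassifier w b) < ⊤) ∧
    -- the bounds
    ENNReal.ofReal (max (Robustness.C₁ ε * √(d : ℝ)) 1) *
        Robustness.rhoAdv μ (Robustness.linearClassifier w b)
      ≤ Robustness.rhoUnif μ ε (Robustness.linearClassifier w b) ∧
    Robustness.rhoUnif μ ε (Robustness.linearClassifier w b)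
      ≤ ENNReal.ofReal (Robustness.C₂tilde ε d) *
        Robustness.rhoAdv μ (Robustness.linearClassifier w b) ∧
    ENNReal.ofReal (Robustness.C₂tilde ε d) *
        Robustness.rhoAdv μ (Robustness.linearClassifier w b)
      ≤ ENNReal.ofReal (Robustness.C₂ ε * √(d : ℝ)) *
        Robustness.rhoAdv μ (Robustness.linearClassifier w b) := by
  obtain ⟨hadv, hunif, hfin, hbounds⟩ := theorem2_general d hd μ w b ε hε₀ hε₁
  exact ⟨hadv, hunif, fun hw ⟨_, hM⟩ => hfin hw (Robustness.integrable_linearClassifier hM w b),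
    hbounds⟩
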